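/- **Theorem 4.5.** Let $\mathbb F\in\{\mathbb R,\mathbb C,\mathbb H\}$ and $q\in\mathbb N$. For $p\in\mathbb N$ let $M_{p,q}$ be the space of $p\times q$-matrices over $\mathbb F$, let $K_p=U_p$ be the compact group of unitary $p\times p$-matrices over $\mathbb F$ with normalized Haar measure $dk$, and let $G_p=M_{p,q}\rtimes U_p$, where $U_p$ acts on $M_{p,q}$ by left multiplication. For $p\le p'$ embed $G_p$ into $G_{p'}$ by $(x,u)\mapsto\left(\begin{pmatrix}x\\0\end{pmatrix},\begin{pmatrix}u&0\\0&I\end{pmatrix}\right)$, and let $G_\infty=\varinjlim G_p=M_{\infty,q}\rtimes U_\infty$, with the inductive limit topology, and $K_\infty=\varinjlim K_p=U_\infty\subset G_\infty$. A function $\phi:G_\infty\to\mathbb C$ is called *Olshanski spherical* if it is continuous, $K_\infty$-biinvariant, not identically zero, and satisfies $$\phi(g)\,\phi(h)=\lim_{p\to\infty}\int_{K_p}\phi(gkh)\,dk\qquad\text{for all } g,h\in G_\infty .$$ Let $H_q$ be the real vector space of Hermitian $q\times q$-matrices over $\mathbb F$ with the Euclidean scalar product $\langle x,y\rangle=\mathrm{Re}\,\mathrm{tr}(xy)$,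 and let $H_q^{\mathbb C}$ be its complexification, on which $\langle\cdot,\cdot\rangle$ also denotes the Hermitian extension of the scalar product (complex linear in the second argument). Let $\Pi_q=\{x^2: x\in H_q\}$ be the cone of positive semidefinite matrices and, for $a\in\Pi_q$, let $g_a=\left(\begin{pmatrix}a\\0_\infty\end{pmatrix},I_\infty\right)\in G_\infty$. Then a continuous $K_\infty$-biinvariant function $\phi:G_\infty\to\mathbb C$ is Olshanski spherical if and only if there is some $b\in H_q^{\mathbb C}$ such that $$\phi(g_a)=\psi_b(a):=\exp\bigl(-\langle a^2,b\rangle\bigr)\qquad\text{for all } a\in\Pi_q .$$ -/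

import Mathlib

open Filter Topology MeasureTheory
open scoped Quaternion

set_option linter.unusedSectionVars false

namespace OlshanskiMotion

noncomputable section

/-- The structure shared by `ℝ`, `ℂ` and `ℍ`, used only to write the definitions below once for
all three (the instances follow; the theorem is about these three): a finite dimensional normed
division algebra over `ℝ` with an involution `star` and a real part `re`, such that
`re t = (t + star t) / 2` and `star t * t = ‖t‖ ^ 2`. -/
class RCH (F : Type) [NormedDivisionRing F] [NormedAlgebra ℝ F] [StarRing F] where
  re : F → ℝ
  algebraMap_re : ∀ t : F, algebraMap ℝ F (re t) = (2⁻¹ : ℝ) • (t + star t)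
  star_mul_self : ∀ t : F, star t * t = algebraMap ℝ F (‖t‖ ^ 2)
  finiteDimensional : FiniteDimensional ℝ F

instance : RCH ℝ where
  re t := t
  algebraMap_re t := by simp; ring
  star_mul_self t := by simp [sq]
  finiteDimensional := inferInstance

instance : RCH ℂ where
  re t := t.re
  algebraMap_re t := by apply Complex.ext <;> simp; ring
  star_mul_self t := by simpa using Complex.conj_mul' t
  finiteDimensional := inferInstance

instance : RCH ℍ[ℝ] where
  re t := t.re
  algebraMap_re t := by
    have h : t + star t = ((2 * t.re : ℝ) : ℍ[ℝ]) := by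
      rw [Quaternion.self_add_star]; push_cast; rfl
    rw [h, ← Quaternion.coe_smul, smul_eq_mul, inv_mul_cancel_left₀ two_ne_zero]
    rfl
  star_mul_self t := by
    rw [Quaternion.star_mul_self, Quaternion.normSq_eq_norm_mul_self, sq]; rfl
  finiteDimensional := inferInstance

variable (F : Type) [NormedDivisionRing F] [NormedAlgebra ℝ F] [StarRing F] [RCH F]

/-! ### The groups `K_p = U_p(F)` with their normalized Haar measures -/

/-- `K_p`, the unitary `p × p` matrices over `F`. -/
abbrev K (p : ℕ) : Type := unitary (Matrix (Fin p) (Fin p) F)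

variable {F} in
theorem RCH.norm_star (t : F) : ‖star t‖ = ‖t‖ := by
  have h := congrArg norm (RCH.star_mul_self t)
  rw [norm_mul, norm_algebraMap', norm_pow, norm_norm, sq] at h
  rcases eq_or_ne t 0 with rfl | ht
  · simp
  · exact mul_right_cancel₀ (norm_ne_zero_iff.2 ht) h

instance instNormedStarGroup : NormedStarGroup F := ⟨fun t => (RCH.norm_star t).le⟩

instance instMeasurableSpaceK (p : ℕ) : MeasurableSpace (K F p) := borel _

instance instBorelSpaceK (p : ℕ) : BorelSpace (K F p) := ⟨rfl⟩

variable {F} in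
theorem norm_entry_le_one {p : ℕ} (u : K F p) (i j : Fin p) :
    ‖(u : Matrix (Fin p) (Fin p) F) i j‖ ≤ 1 := by
  have h : (star (u : Matrix (Fin p) (Fin p) F) * (u : Matrix (Fin p) (Fin p) F)) j j = 1 := by
    rw [Unitary.coe_star_mul_self]; simp
  have h2 : algebraMap ℝ F (∑ k, ‖(u : Matrix (Fin p) (Fin p) F) k j‖ ^ 2)
      = algebraMap ℝ F 1 := by
    rw [map_one, ← h, Matrix.mul_apply, map_sum]
    exact Finset.sum_congr rfl fun k _ => (RCH.star_mul_self _).symm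
  have h3 : ∑ k, ‖(u : Matrix (Fin p) (Fin p) F) k j‖ ^ 2 = 1 := (algebraMap ℝ F).injective h2
  have h4 : ‖(u : Matrix (Fin p) (Fin p) F) i j‖ ^ 2 ≤ 1 := h3 ▸
    Finset.single_le_sum (f := fun k => ‖(u : Matrix (Fin p) (Fin p) F) k j‖ ^ 2)
      (fun k _ => sq_nonneg _) (Finset.mem_univ i)
  exact (sq_le_one_iff₀ (norm_nonneg _)).1 h4

instance instCompactSpaceK (p : ℕ) : CompactSpace (K F p) := by
  have : FiniteDimensional ℝ F := RCH.finiteDimensional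
  have : ProperSpace F := FiniteDimensional.proper ℝ F
  have hc : IsCompact (Set.univ.pi fun _ : Fin p => Set.univ.pi fun _ : Fin p =>
      Metric.closedBall (0 : F) 1) :=
    isCompact_univ_pi fun _ => isCompact_univ_pi fun _ => isCompact_closedBall 0 1
  have hcl : IsClosed (unitary (Matrix (Fin p) (Fin p) F) : Set (Matrix (Fin p) (Fin p) F)) :=
    isClosed_unitary
  refine isCompact_iff_compactSpace.1 (hc.of_isClosed_subset hcl ?_)
  intro u hu i _ j _
  simpa using norm_entry_le_one (⟨u, hu⟩ : K F p) i j

/-- The Haar measure of `K_p`, normalized to total mass one. -/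
def haarK (p : ℕ) : Measure (K F p) := Measure.haarMeasure ⊤

instance instIsHaarMeasureK (p : ℕ) : (haarK F p).IsHaarMeasure := by
  unfold haarK; infer_instance

instance instIsProbabilityMeasureK (p : ℕ) : IsProbabilityMeasure (haarK F p) := by
  refine ⟨?_⟩
  simpa [haarK] using
    Measure.haarMeasure_self (K₀ := (⊤ : TopologicalSpace.PositiveCompacts (K F p)))

/-! ### The motion groups `G_p = M_{p,q} ⋊ U_p` -/

/-- The action of `U_p` on (the additive group of) `M_{p,q}` by left multiplication. -/
def act (p q : ℕ) : K F p →* MulAut (Multiplicative (Matrix (Fin p) (Fin q) F)) where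
  toFun u :=
    { toFun := fun x => .ofAdd (HMul.hMul (α := Matrix (Fin p) (Fin p) F) u.1 x.toAdd)
      invFun := fun x => .ofAdd (star u.1 * x.toAdd : Matrix (Fin p) (Fin q) F)
      left_inv := fun x => by simp [← Matrix.mul_assoc]
      right_inv := fun x => by simp [← Matrix.mul_assoc]
      map_mul' := fun x y => by simp [Matrix.mul_add] }
  map_one' := by ext x : 1; simp
  map_mul' u v := by ext x : 1; simp [Matrix.mul_assoc]

/-- `G_p = M_{p,q} ⋊ U_p`, with product `(x, u) (y, v) = (x + u y, u v)`. -/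
abbrev G (p q : ℕ) : Type := Multiplicative (Matrix (Fin p) (Fin q) F) ⋊[act F p q] K F p

/-- `G_p` carries the topology of the product `M_{p,q} × U_p`. -/
instance instTopologicalSpaceG (p q : ℕ) : TopologicalSpace (G F p q) :=
  .induced (fun g => (g.left.toAdd, g.right)) inferInstance

/-! ### The embeddings `G_p → G_p'` for `p ≤ p'` -/

variable {F}

/-- `x ↦ (x ; 0)`, adding zero rows. -/
def extM {p p' q : ℕ} (x : Matrix (Fin p) (Fin q) F) : Matrix (Fin p') (Fin q) F :=
  fun i j => if h : (i : ℕ) < p then x ⟨i, h⟩ j else 0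

/-- `u ↦ diag (u, I)`. -/
def extU {p p' : ℕ} (u : Matrix (Fin p) (Fin p) F) : Matrix (Fin p') (Fin p') F :=
  fun i j => if h : (i : ℕ) < p ∧ (j : ℕ) < p then u ⟨i, h.1⟩ ⟨j, h.2⟩ else if i = j then 1 else 0

theorem sum_castLE {p p' : ℕ} (h : p ≤ p') (f : Fin p' → F)
    (hf : ∀ k : Fin p', ¬ (k : ℕ) < p → f k = 0) :
    ∑ k, f k = ∑ k : Fin p, f (Fin.castLE h k) := by
  symm
  refine Finset.sum_of_injOn (Fin.castLE h) (Fin.castLE_injective h).injOn (by simp) ?_ (by simp)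
  intro k _ hk
  exact hf k fun hlt => hk ⟨⟨k, hlt⟩, by simp, by ext; simp⟩

theorem extU_mul_extM {p p' q : ℕ} (h : p ≤ p') (u : Matrix (Fin p) (Fin p) F)
    (x : Matrix (Fin p) (Fin q) F) :
    (extU u : Matrix (Fin p') (Fin p') F) * (extM x : Matrix (Fin p') (Fin q) F)
      = extM (u * x) := by
  ext i j
  rw [Matrix.mul_apply, sum_castLE h]
  · by_cases hi : (i : ℕ) < p
    · simp [extU, extM, hi, Matrix.mul_apply]
    · have : ∀ k : Fin p, i ≠ Fin.castLE h k := fun k hk => hi (by rw [hk]; simp)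
      simp [extU, extM, hi, this]
  · intro k hk
    simp [extM, hk]

theorem extU_mul {p p' : ℕ} (h : p ≤ p') (u v : Matrix (Fin p) (Fin p) F) :
    (extU (u * v) : Matrix (Fin p') (Fin p') F) = extU u * extU v := by
  ext i j
  rw [Matrix.mul_apply]
  by_cases hi : (i : ℕ) < p
  · rw [sum_castLE h]
    · by_cases hj : (j : ℕ) < p
      · simp [extU, hi, hj, Matrix.mul_apply]
      · have h1 : ∀ k : Fin p, Fin.castLE h k ≠ j := fun k hk => hj (by rw [← hk]; simp)
        have h2 : i ≠ j := fun hk => hj (by rw [← hk]; exact hi)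
        simp [extU, hj, h1, h2]
    · intro k hk
      have : i ≠ k := fun h => hk (h ▸ hi)
      simp [extU, hk, this]
  · have h1 : ∀ (w : Matrix (Fin p) (Fin p) F) (k : Fin p'),
        extU w i k = if i = k then 1 else 0 := fun w k => by simp [extU, hi]
    simp [h1]

theorem extU_one {p p' : ℕ} :
    (extU (1 : Matrix (Fin p) (Fin p) F) : Matrix (Fin p') (Fin p') F) = 1 := by
  ext i j
  simp only [extU, Matrix.one_apply, Fin.ext_iff]
  split_ifs <;> rfl

theorem extU_star {p p' : ℕ} (u : Matrix (Fin p) (Fin p) F) :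
    (extU (star u) : Matrix (Fin p') (Fin p') F) = star (extU u) := by
  ext i j
  simp only [extU, Matrix.star_apply]
  by_cases h : (i : ℕ) < p ∧ (j : ℕ) < p
  · simp [h]
  · have h' : ¬ ((j : ℕ) < p ∧ (i : ℕ) < p) := fun h' => h h'.symm
    by_cases hij : i = j
    · subst hij
      have hi : ¬ (i : ℕ) < p := fun hi => h ⟨hi, hi⟩
      simp [hi]
    · simp [h, h', hij, Ne.symm hij]

/-- The embedding `u ↦ diag (u, I)` of `K_p` into `K_p'`. -/
def embK (p p' : ℕ) (h : p ≤ p') : K F p →* K F p' where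
  toFun u := ⟨extU u.1, by
    rw [Unitary.mem_iff, ← extU_star, ← extU_mul h, ← extU_mul h]
    simp [extU_one]⟩
  map_one' := Subtype.ext extU_one
  map_mul' u v := Subtype.ext (extU_mul h u.1 v.1)

variable (F)

/-- The embedding `(x, u) ↦ ((x ; 0), diag (u, I))` of `G_p` into `G_p'`. -/
def embG (q p p' : ℕ) (h : p ≤ p') : G F p q →* G F p' q :=
  SemidirectProduct.map
    { toFun := fun x => .ofAdd (extM x.toAdd)
      map_one' := by ext i j; simp [extM]
      map_mul' := fun x y => by
        refine Multiplicative.toAdd.injective ?_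
        ext i j
        simp only [toAdd_mul, toAdd_ofAdd, extM, Matrix.add_apply]
        split_ifs <;> simp }
    (embK p p' h)
    (fun u => by
      refine MonoidHom.ext fun x => ?_
      exact congrArg Multiplicative.ofAdd (extU_mul_extM h u.1 x.toAdd).symm)

instance instDirectedSystemG (q : ℕ) :
    DirectedSystem (fun p => G F p q) (embG F q · · ·) where
  map_self p g := by
    refine SemidirectProduct.ext ?_ (Subtype.ext ?_)
    · refine Multiplicative.toAdd.injective ?_
      ext i j; simp [embG, extM]
    · ext i j; simp [embG, embK, extU]
  map_map p'' p' p h h' g := by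
    refine SemidirectProduct.ext ?_ (Subtype.ext ?_)
    · refine Multiplicative.toAdd.injective ?_
      ext i j
      by_cases hi : (i : ℕ) < p
      · simp [embG, extM, hi, hi.trans_le h]
      · simp [embG, extM, hi]
    · ext i j
      change (if _ : _ then (if _ : _ then _ else _) else _) = if _ : _ then _ else _
      by_cases hp : (i : ℕ) < p ∧ (j : ℕ) < p
      · have hp' : (i : ℕ) < p' ∧ (j : ℕ) < p' := ⟨hp.1.trans_le h, hp.2.trans_le h⟩
        simp [hp, hp']
      · by_cases hp' : (i : ℕ) < p' ∧ (j : ℕ) < p' <;> simp [hp, hp', Fin.ext_iff]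

/-! ### The inductive limits -/

/-- `G_∞ = lim G_p`, the direct limit of the groups `G_p`: a quotient of the disjoint union of the
`G_p`. It carries the quotient topology, which is the inductive limit topology, as
`continuous_GInf_iff` shows. -/
abbrev GInf (q : ℕ) : Type := DirectLimit (fun p => G F p q) (embG F q)

/-- The canonical map `G_p → G_∞`. -/
def ι (q p : ℕ) : G F p q →* GInf F q where
  toFun g := ⟦⟨p, g⟩⟧
  map_one' := (DirectLimit.one_def (f := embG F q) p).symm
  map_mul' g h := (DirectLimit.mul_def (f := embG F q) p g h).symm

theorem continuous_GInf_iff (q : ℕ) {X : Type*} [TopologicalSpace X] (φ : GInf F q → X) :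
    Continuous φ ↔ ∀ p, Continuous fun g : G F p q => φ (ι F q p g) :=
  (isQuotientMap_quotient_mk' (s := DirectLimit.setoid (embG F q))).continuous_iff.trans
    (continuous_sigma_iff (f := fun x => φ ⟦x⟧))

/-- `K_∞ = lim K_p`, as the subgroup of `G_∞` that is the union of the (increasing) images of the
subgroups `K_p` of `G_p`. -/
def KInf (q : ℕ) : Subgroup (GInf F q) :=
  ⨆ p, (SemidirectProduct.inr.range : Subgroup (G F p q)).map (ι F q p)

theorem mem_KInf_iff (q : ℕ) (g : GInf F q) :
    g ∈ KInf F q ↔ ∃ (p : ℕ) (k : K F p), ι F q p (SemidirectProduct.inr k) = g := by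
  rw [KInf, Subgroup.mem_iSup_of_directed]
  · simp
  · refine Monotone.directed_le fun p p' h => ?_
    rintro _ ⟨_, ⟨k, rfl⟩, rfl⟩
    refine ⟨_, ⟨embK p p' h k, rfl⟩, ?_⟩
    refine Eq.trans (congrArg (ι F q p') ?_)
      (DirectLimit.mk_apply (f := embG F q) p p' (SemidirectProduct.inr k) h)
    exact (SemidirectProduct.map_inr ..).symm

/-! ### Hermitian matrices -/

/-- `H_q`, the Hermitian `q × q` matrices over `F`. -/
abbrev H (q : ℕ) : Type := selfAdjoint (Matrix (Fin q) (Fin q) F)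

/-- The cone `Π_q = {x ^ 2 : x ∈ H_q}` of positive semidefinite matrices. -/
def posCone (q : ℕ) : Set (H F q) := {a | ∃ x : H F q, a = x ^ 2}

variable {F}

/-- The Euclidean scalar product `⟨x, y⟩ = Re tr (x y)` of `H_q`. -/
def scalar {q : ℕ} (x y : H F q) : ℝ :=
  RCH.re (Matrix.trace ((x : Matrix (Fin q) (Fin q) F) * (y : Matrix (Fin q) (Fin q) F)))

variable (F) in
/-- The complexification `H_q + i H_q` of the real vector space `H_q`: the element `x + i y` is
stored as the pair of `x = re` and `y = im`. -/
@[ext]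
structure HC (q : ℕ) where
  re : H F q
  im : H F q

/-- The inclusion of `H_q` into its complexification. -/
def HC.ofReal {q : ℕ} (x : H F q) : HC F q := ⟨x, 0⟩

/-- The Hermitian extension of the scalar product to the complexification (conjugate linear in the
first and complex linear in the second argument). -/
def HC.scalar {q : ℕ} (z w : HC F q) : ℂ :=
  ((OlshanskiMotion.scalar z.re w.re + OlshanskiMotion.scalar z.im w.im : ℝ) : ℂ) +
    ((OlshanskiMotion.scalar z.re w.im - OlshanskiMotion.scalar z.im w.re : ℝ) : ℂ) * Complex.I

/-- The function `ψ_b(a) = exp (-⟨a ^ 2, b⟩)`. -/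
def psi {q : ℕ} (b : HC F q) (a : H F q) : ℂ :=
  Complex.exp (-HC.scalar (HC.ofReal (a ^ 2)) b)

/-! ### Biinvariant and spherical functions -/

/-- `g_a = ((a ; 0), I)`: the image in `G_∞` of the element `(a, I)` of `G_q`. -/
def gOf {q : ℕ} (a : H F q) : GInf F q :=
  ι F q q (SemidirectProduct.inl (.ofAdd (a : Matrix (Fin q) (Fin q) F)))

/-- `φ (k g k') = φ g` for all `k, k' ∈ K_∞`. -/
def IsBiinvariant {q : ℕ} (φ : GInf F q → ℂ) : Prop :=
  ∀ k ∈ KInf F q, ∀ k' ∈ KInf F q, ∀ g, φ (k * g * k') = φ g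

/-- Olshanski spherical functions: nonzero continuous `K_∞`-biinvariant functions with
`φ(g) φ(h) = lim_{p → ∞} ∫_{K_p} φ(g k h) dk`. -/
structure IsOlshanskiSpherical {q : ℕ} (φ : GInf F q → ℂ) : Prop where
  ne_zero : φ ≠ 0
  continuous : Continuous φ
  biinvariant : IsBiinvariant φ
  product_formula : ∀ g h : GInf F q,
    Tendsto (fun p => ∫ k : K F p, φ (g * ι F q p (SemidirectProduct.inr k) * h) ∂haarK F p)
      atTop (𝓝 (φ g * φ h))

end

end OlshanskiMotion

namespace OlshanskiMotion

noncomputable section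

open Matrix

/-! ### The real part and the trace form -/

variable {F : Type} [NormedDivisionRing F] [NormedAlgebra ℝ F] [StarRing F] [RCH F]

/-! A continuous biinvariant `φ` is a function of the Gram matrix `xᴴ * x` alone. At `(x, u)` the
factor `u` drops out. After adding zero rows, unitaries carry any two matrices with the same Gram
matrix to the same `(0 ; a)`, with `a` its positive square root (`IsBiinvariant.trans_congr`). So
`φ` amounts to a function `profile φ` on the cone of positive semidefinite matrices.

If `x`, `y` have `m` rows, the Gram matrix of `x + k y` is `xᴴ * x + yᴴ * y` plus cross terms that
see only the `m × m` corner of `k`. A Haar entry has second moment `1 / p`, so the corner tends to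
zero in mean square and the averages of `φ` tend to `profile φ (xᴴ * x + yᴴ * y)`
(`IsBiinvariant.tendsto_integral_trans`). This holds for every continuous biinvariant `φ`; being
spherical therefore means that the profile is nonzero and turns sums into products
(`IsBiinvariant.isOlshanskiSpherical_iff`).

Such a profile is 1 at 0, vanishes nowhere, and extends by quotients to a homomorphism from the
additive group `H_q` to `ℂ^×`, continuous on lines. Hence it is the exponential of a real linear
functional (`IsBiinvariant.exists_linearMap`), which the scalar product represents by some `b`.
Conversely `s ↦ exp (-⟨s, b⟩)` is nonzero and multiplicative.

The argument is uniform in `F`: square roots come from the real spectral theorem, so the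
noncommutativity of `ℍ` plays no role. -/

theorem RCH.star_algebraMap (r : ℝ) : star (algebraMap ℝ F r) = algebraMap ℝ F r := by
  rcases eq_or_ne r 0 with rfl | hr
  · simp
  -- Both `star r * r` and `r * r` equal `|r| ^ 2`; cancel `r`.
  · have h := RCH.star_mul_self (algebraMap ℝ F r)
    rw [norm_algebraMap', Real.norm_eq_abs, sq_abs, sq, map_mul] at h
    exact mul_right_cancel₀ (by simpa using hr) h

instance instStarModuleRCH : StarModule ℝ F where
  star_smul r t := by
    rw [Algebra.smul_def, star_mul, RCH.star_algebraMap, ← Algebra.commutes, star_trivial r,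
      Algebra.smul_def]

/-- The real part as a linear functional. -/
def RCH.reₗ : F →ₗ[ℝ] ℝ where
  toFun := RCH.re
  map_add' s t := (algebraMap ℝ F).injective (by
    simp only [map_add, RCH.algebraMap_re, star_add, ← smul_add]
    congr 1; abel)
  map_smul' r t := (algebraMap ℝ F).injective (by
    rw [RingHom.id_apply, smul_eq_mul, map_mul, RCH.algebraMap_re, RCH.algebraMap_re, star_smul,
      star_trivial, ← smul_add, smul_comm, Algebra.smul_def r])

theorem RCH.re_eq (t : F) : RCH.re t = RCH.reₗ t := rfl

@[simp]
theorem RCH.reₗ_algebraMap (r : ℝ) : RCH.reₗ (algebraMap ℝ F r) = r := by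
  refine (algebraMap ℝ F).injective ?_
  rw [← RCH.re_eq, RCH.algebraMap_re, RCH.star_algebraMap, ← two_smul ℝ, smul_smul]
  norm_num

@[simp]
theorem RCH.reₗ_star (t : F) : RCH.reₗ (star t) = RCH.reₗ t := by
  refine (algebraMap ℝ F).injective ?_
  rw [← RCH.re_eq, ← RCH.re_eq, RCH.algebraMap_re, RCH.algebraMap_re, star_star, add_comm]

theorem trace_conjTranspose_mul_self {m n : ℕ} (X : Matrix (Fin m) (Fin n) F) :
    trace (Xᴴ * X) = algebraMap ℝ F (∑ j, ∑ i, ‖X i j‖ ^ 2) := by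
  simp [Matrix.trace, Matrix.mul_apply, map_sum, RCH.star_mul_self]

theorem conjTranspose_mul_self_apply {m n : ℕ} (X : Matrix (Fin m) (Fin n) F) (j : Fin n) :
    (Xᴴ * X) j j = algebraMap ℝ F (∑ i, ‖X i j‖ ^ 2) := by
  simp [Matrix.mul_apply, map_sum, RCH.star_mul_self]

theorem conjTranspose_mul_self_eq_zero_iff {m n : ℕ} {X : Matrix (Fin m) (Fin n) F} :
    Xᴴ * X = 0 ↔ X = 0 := by
  refine ⟨fun h => ?_, fun h => by simp [h]⟩
  ext i j
  have hj := congrFun (congrFun h j) j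
  rw [conjTranspose_mul_self_apply, Matrix.zero_apply, map_eq_zero_iff _ (algebraMap ℝ F).injective,
    Finset.sum_eq_zero_iff_of_nonneg fun _ _ => sq_nonneg _] at hj
  simpa using hj i (Finset.mem_univ i)

/-- The Euclidean scalar product `Re tr (X^* Y)` on matrices. -/
def traceForm {m n : ℕ} (X Y : Matrix (Fin m) (Fin n) F) : ℝ := RCH.reₗ (trace (Xᴴ * Y))

theorem traceForm_self {m n : ℕ} (X : Matrix (Fin m) (Fin n) F) :
    traceForm X X = ∑ j, ∑ i, ‖X i j‖ ^ 2 := by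
  rw [traceForm, trace_conjTranspose_mul_self, RCH.reₗ_algebraMap]

theorem traceForm_self_nonneg {m n : ℕ} (X : Matrix (Fin m) (Fin n) F) : 0 ≤ traceForm X X := by
  rw [traceForm_self]; positivity

theorem traceForm_self_eq_zero {m n : ℕ} {X : Matrix (Fin m) (Fin n) F} (h : traceForm X X = 0) :
    X = 0 := by
  rw [traceForm, trace_conjTranspose_mul_self, RCH.reₗ_algebraMap,
    ← map_eq_zero_iff _ (algebraMap ℝ F).injective, ← trace_conjTranspose_mul_self] at h
  rw [trace_conjTranspose_mul_self, map_eq_zero_iff _ (algebraMap ℝ F).injective,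
    Finset.sum_eq_zero_iff_of_nonneg fun _ _ => by positivity] at h
  ext i j
  have hj := h j (Finset.mem_univ j)
  rw [Finset.sum_eq_zero_iff_of_nonneg fun _ _ => by positivity] at hj
  simpa using hj i (Finset.mem_univ i)

variable (F) in
/-- The trace form makes the square matrices a Euclidean space. -/
abbrev matrixInnerCore (q : ℕ) : InnerProductSpace.Core ℝ (Matrix (Fin q) (Fin q) F) where
  inner X Y := traceForm X Y
  conj_inner_symm X Y := by
    change traceForm Y X = traceForm X Y
    -- Over `ℍ` the trace is not cyclic; symmetry comes from the real part being invariant under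
    -- `star`.
    rw [traceForm, traceForm, ← RCH.reₗ_star, ← trace_conjTranspose, conjTranspose_mul,
      conjTranspose_conjTranspose]
  re_inner_nonneg X := traceForm_self_nonneg X
  add_left X Y Z := by simp [traceForm, Matrix.add_mul]
  smul_left X Y r := by simp [traceForm, conjTranspose_smul]
  definite X h := traceForm_self_eq_zero h

/-! ### Functional calculus for Gram matrices -/

section FunctionalCalculus

open Polynomial

/-- Spectral theorem for `s = x^* x`: a polynomial in `s` depends only on the values of the
polynomial at finitely many nonnegative reals. -/
theorem exists_finset_aeval_eq_zero {m q : ℕ} (x : Matrix (Fin m) (Fin q) F) :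
    ∃ Λ : Finset ℝ, (∀ t ∈ Λ, 0 ≤ t) ∧
      ∀ P : ℝ[X], (∀ t ∈ Λ, P.eval t = 0) → aeval (xᴴ * x) P = 0 := by
  classical
  have : FiniteDimensional ℝ F := RCH.finiteDimensional
  let _ : NormedAddCommGroup (Matrix (Fin q) (Fin q) F) := (matrixInnerCore F q).toNormedAddCommGroup
  let _ : InnerProductSpace ℝ (Matrix (Fin q) (Fin q) F) := .ofCore (matrixInnerCore F q).toCore
  have inner_def : ∀ X Y : Matrix (Fin q) (Fin q) F, inner ℝ X Y = traceForm X Y :=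
    fun _ _ => rfl
  -- Left multiplication by `xᴴ * x` is a symmetric operator on a real Euclidean space, whatever `F`
  -- is, so the real spectral theorem applies to it.
  let T : Matrix (Fin q) (Fin q) F →ₗ[ℝ] Matrix (Fin q) (Fin q) F :=
    Algebra.lmul ℝ (Matrix (Fin q) (Fin q) F) (xᴴ * x)
  have hT : T.IsSymmetric := by
    intro X Y
    simp only [inner_def, traceForm, T, Algebra.coe_lmul_eq_mul, LinearMap.mul_apply',
      conjTranspose_mul, conjTranspose_conjTranspose, Matrix.mul_assoc]
  let b := hT.eigenvectorBasis rfl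
  have hb : ∀ i, T (b i) = hT.eigenvalues rfl i • b i := fun i =>
    hT.apply_eigenvectorBasis rfl i
  refine ⟨Finset.univ.image (hT.eigenvalues rfl), ?_, fun P hP => ?_⟩
  · simp only [Finset.mem_image, Finset.mem_univ, true_and, forall_exists_index]
    rintro _ i rfl
    have h1 : inner ℝ (b i) (T (b i)) = hT.eigenvalues rfl i := by
      rw [hb, inner_smul_right, real_inner_self_eq_norm_sq, b.orthonormal.1 i]; simp
    have h2 : inner ℝ (b i) (T (b i)) = traceForm (x * b i) (x * b i) := by
      simp only [inner_def, traceForm, T, Algebra.coe_lmul_eq_mul, LinearMap.mul_apply',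
        conjTranspose_mul, Matrix.mul_assoc]
    rw [← h1, h2]
    exact traceForm_self_nonneg _
  · have h0 : aeval T P = 0 := by
      refine b.toBasis.ext fun i => ?_
      rw [OrthonormalBasis.coe_toBasis, LinearMap.zero_apply,
        Module.End.aeval_apply_of_hasEigenvector (μ := hT.eigenvalues rfl i)
          (hT.hasEigenvector_eigenvectorBasis rfl i),
        hP _ (Finset.mem_image_of_mem _ (Finset.mem_univ i)), zero_smul]
    -- `P(T)` is left multiplication by `P(xᴴ * x)`; evaluating at `1` recovers the matrix.
    rw [aeval_algHom_apply] at h0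
    simpa using congrArg (fun S : Module.End ℝ (Matrix (Fin q) (Fin q) F) => S 1) h0

theorem conjTranspose_aeval {q : ℕ} {s : Matrix (Fin q) (Fin q) F} (hs : sᴴ = s) (P : ℝ[X]) :
    (aeval s P)ᴴ = aeval s P := by
  induction P using Polynomial.induction_on' with
  | add P Q hP hQ => simp [hP, hQ]
  | monomial n r =>
    rw [aeval_monomial, ← Algebra.smul_def, conjTranspose_smul, conjTranspose_pow, hs, star_trivial]

/-- A Gram matrix `s` has a fourth root `c` whose square `a` has a pseudo-inverse `r`. -/
theorem exists_fourthRoot {m q : ℕ} (x : Matrix (Fin m) (Fin q) F) :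
    ∃ c r : Matrix (Fin q) (Fin q) F, cᴴ = c ∧ rᴴ = r ∧ c ^ 2 * c ^ 2 = xᴴ * x ∧
      r * (xᴴ * x) = c ^ 2 ∧ r * c ^ 2 = c ^ 2 * r ∧ c ^ 2 * r * c ^ 2 = c ^ 2 ∧
      r * c ^ 2 * r = r := by
  classical
  obtain ⟨Λ, hΛ, h0⟩ := exists_finset_aeval_eq_zero x
  have hs : (xᴴ * x)ᴴ = xᴴ * x := by simp
  have key : ∀ P Q : ℝ[X], (∀ t ∈ Λ, P.eval t = Q.eval t) →
      aeval (xᴴ * x) P = aeval (xᴴ * x) Q := by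
    intro P Q h
    rw [← sub_eq_zero, ← map_sub]
    exact h0 _ fun t ht => by rw [eval_sub, h t ht, sub_self]
  -- A fourth root, so that the square root `c ^ 2` is visibly the square of a Hermitian matrix, as
  -- `posCone` demands. In `R` the convention `0⁻¹ = 0` produces the pseudo-inverse.
  let C : ℝ[X] := Lagrange.interpolate Λ id fun t => √√t
  let R : ℝ[X] := Lagrange.interpolate Λ id fun t => (√t)⁻¹
  have hC : ∀ t ∈ Λ, C.eval t ^ 2 = √t := fun t ht => by
    rw [show C.eval t = √√t from
      Lagrange.eval_interpolate_at_node (v := id) _ (Function.injective_id.injOn) ht,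
      Real.sq_sqrt (Real.sqrt_nonneg t)]
  have hR : ∀ t ∈ Λ, R.eval t = (√t)⁻¹ := fun t ht =>
    Lagrange.eval_interpolate_at_node (v := id) _ (Function.injective_id.injOn) ht
  have hX : xᴴ * x = aeval (xᴴ * x) (X : ℝ[X]) := (aeval_X _).symm
  refine ⟨aeval (xᴴ * x) C, aeval (xᴴ * x) R, conjTranspose_aeval hs C, conjTranspose_aeval hs R,
    ?_, ?_, ?_, ?_, ?_⟩
  · refine Eq.trans ?_ hX.symm
    rw [← map_pow, ← map_mul]
    refine key _ _ fun t ht => ?_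
    simp only [eval_mul, eval_pow, hC t ht, eval_X]
    exact Real.mul_self_sqrt (hΛ t ht)
  · refine (congrArg (aeval (xᴴ * x) R * ·) hX).trans ?_
    rw [← map_pow, ← map_mul]
    refine key _ _ fun t ht => ?_
    simp only [eval_mul, eval_pow, hC t ht, eval_X, hR t ht]
    rcases eq_or_ne (√t) 0 with h | h
    · rw [h, _root_.inv_zero, zero_mul]
    · rw [inv_mul_eq_iff_eq_mul₀ h, Real.mul_self_sqrt (hΛ t ht)]
  · rw [← map_pow, ← map_mul, ← map_mul, mul_comm]
  · simp only [← map_pow, ← map_mul]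
    refine key _ _ fun t ht => ?_
    simp only [eval_mul, eval_pow, hC t ht, hR t ht, mul_inv_mul_cancel]
  · simp only [← map_pow, ← map_mul]
    refine key _ _ fun t ht => ?_
    simp only [eval_mul, eval_pow, hC t ht, hR t ht]
    rcases eq_or_ne (√t) 0 with h | h
    · simp [h]
    · field_simp

end FunctionalCalculus

/-! ### Double cosets of `K_∞` -/

theorem conjTranspose_extM_mul_extM {p p' q : ℕ} (h : p ≤ p') (x y : Matrix (Fin p) (Fin q) F) :
    (extM x : Matrix (Fin p') (Fin q) F)ᴴ * (extM y : Matrix (Fin p') (Fin q) F) = xᴴ * y := by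
  ext i j
  rw [Matrix.mul_apply, sum_castLE h, Matrix.mul_apply]
  · simp [extM]
  · intro k hk
    simp [extM, hk]

/-- The matrix `(x ; y)` obtained by stacking `x` and `y`. -/
def stack {m n q : ℕ} (x : Matrix (Fin m) (Fin q) F) (y : Matrix (Fin n) (Fin q) F) :
    Matrix (Fin (m + n)) (Fin q) F :=
  (fromRows x y).submatrix finSumFinEquiv.symm id

theorem conjTranspose_stack_mul_stack {m n q : ℕ} (x x' : Matrix (Fin m) (Fin q) F)
    (y y' : Matrix (Fin n) (Fin q) F) : (stack x y)ᴴ * stack x' y' = xᴴ * x' + yᴴ * y' := by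
  ext i j
  simp [stack, Matrix.mul_apply, Fin.sum_univ_add]

theorem extM_eq_stack {m n q : ℕ} (x : Matrix (Fin m) (Fin q) F) :
    (extM x : Matrix (Fin (m + n)) (Fin q) F) = stack x 0 := by
  ext i j
  refine Fin.addCases (fun i => ?_) (fun i => ?_) i <;> simp [extM, stack]

/-- If `r` is a pseudo-inverse of a square root `a` of `x^* x`, then some unitary matrix maps
`(x ; 0)` to `(0 ; a)`. -/
theorem exists_unitary_mul_extM {m q : ℕ} (x : Matrix (Fin m) (Fin q) F)
    {a r : Matrix (Fin q) (Fin q) F} (hr : rᴴ = r) (ha : aᴴ = a) (hs : a * a = xᴴ * x)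
    (hra : r * (xᴴ * x) = a) (hcomm : r * a = a * r) (hara : a * r * a = a) (hrar : r * a * r = r) :
    ∃ U : K F (m + q), (U : Matrix (Fin (m + q)) (Fin (m + q)) F) *
      (extM x : Matrix (Fin (m + q)) (Fin q) F) = stack 0 a := by
  -- The partial isometry in the polar decomposition `x = V * a`; `Vᴴ * V = a * r` is its initial
  -- projection.
  set V := x * r with hV
  have hVstar : Vᴴ = r * xᴴ := by rw [hV, conjTranspose_mul, hr]
  have hVx : Vᴴ * x = a := by rw [hVstar, Matrix.mul_assoc, hra]
  have hVV : Vᴴ * V = a * r := by rw [hV, ← Matrix.mul_assoc, hVx]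
  have hVe : V * (a * r) = V := by rw [hV, Matrix.mul_assoc, ← Matrix.mul_assoc r, hrar]
  have heV : a * r * Vᴴ = Vᴴ := by
    rw [hVstar, ← hcomm, ← Matrix.mul_assoc, hrar]
  have hee : a * r * (a * r) = a * r := by rw [← Matrix.mul_assoc, hara]
  have hx : V * a = x := by
    have h1 : (x - V * a)ᴴ * (x - V * a) = 0 := by
      have h2 : xᴴ * (V * a) = a * a := by
        rw [hV, ← Matrix.mul_assoc, ← Matrix.mul_assoc, ← hs, Matrix.mul_assoc a a r, ← hcomm,
          ← Matrix.mul_assoc a r a, hara]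
      have h3 : (V * a)ᴴ * x = a * a := by rw [conjTranspose_mul, ha, Matrix.mul_assoc, hVx]
      have h4 : (V * a)ᴴ * (V * a) = a * a := by
        rw [conjTranspose_mul, ha, Matrix.mul_assoc, ← Matrix.mul_assoc Vᴴ, hVV, hara]
      rw [conjTranspose_sub, Matrix.sub_mul, Matrix.mul_sub, Matrix.mul_sub, h2, h3, h4, ← hs]
      simp
    exact (sub_eq_zero.1 (conjTranspose_mul_self_eq_zero_iff.1 h1)).symm
  -- A Hermitian involution of `F^m ⊕ F^q`: it exchanges the final and initial spaces of `V` and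
  -- fixes their complements. The `q` extra rows make room for it, so `V` need not be extended to a
  -- unitary.
  let B : Matrix (Fin m ⊕ Fin q) (Fin m ⊕ Fin q) F := fromBlocks (1 - V * Vᴴ) V Vᴴ (1 - a * r)
  have hBstar : Bᴴ = B := by
    simp only [B, fromBlocks_conjTranspose, conjTranspose_sub, conjTranspose_one,
      conjTranspose_mul, conjTranspose_conjTranspose]
    rw [hr, ha, hcomm]
  have hBB : B * B = 1 := by
    have e1 : V * Vᴴ * (V * Vᴴ) = V * Vᴴ := by
      rw [Matrix.mul_assoc, ← Matrix.mul_assoc Vᴴ, hVV, heV]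
    have e2 : V * Vᴴ * V = V := by rw [Matrix.mul_assoc, hVV, hVe]
    have e3 : Vᴴ * (V * Vᴴ) = Vᴴ := by rw [← Matrix.mul_assoc, hVV, heV]
    simp only [B, fromBlocks_multiply]
    rw [← fromBlocks_one]
    congr 1
    · rw [Matrix.sub_mul, Matrix.one_mul, Matrix.mul_sub, Matrix.mul_one, e1]; simp
    · rw [Matrix.sub_mul, Matrix.mul_sub, e2, hVe]; simp
    · rw [Matrix.sub_mul, Matrix.mul_sub, e3, heV]; simp
    · rw [Matrix.sub_mul, Matrix.one_mul, Matrix.mul_sub, Matrix.mul_one, hVV, hee]; simp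
  let e := (finSumFinEquiv (m := m) (n := q)).symm
  have hstar : star (B.submatrix e e) = B.submatrix e e := by
    rw [star_eq_conjTranspose, conjTranspose_submatrix, hBstar]
  have hsq : B.submatrix e e * B.submatrix e e = 1 := by
    rw [submatrix_mul_equiv, hBB, submatrix_one_equiv]
  refine ⟨⟨B.submatrix e e, ?_⟩, ?_⟩
  · rw [Unitary.mem_iff, hstar]
    exact ⟨hsq, hsq⟩
  · rw [extM_eq_stack, stack, stack]
    change B.submatrix e e * (fromRows x 0).submatrix e id = _
    rw [submatrix_mul_equiv]
    congr 1
    rw [fromBlocks_mul_fromRows, Matrix.mul_zero, Matrix.mul_zero, add_zero, add_zero, hVx,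
      Matrix.sub_mul, Matrix.one_mul, Matrix.mul_assoc, hVx, hx, sub_self]

variable (F) in
/-- The element `(x, 1)` of `G_∞`. -/
def trans {p q : ℕ} (x : Matrix (Fin p) (Fin q) F) : GInf F q :=
  ι F q p (SemidirectProduct.inl (.ofAdd x))

theorem ι_embG {q p p' : ℕ} (h : p ≤ p') (g : G F p q) : ι F q p' (embG F q p p' h g) = ι F q p g := by
  have := DirectLimit.mk_apply (f := embG F q) p p' g h
  exact this

theorem trans_extM {q p p' : ℕ} (h : p ≤ p') (x : Matrix (Fin p) (Fin q) F) :
    trans F (extM x : Matrix (Fin p') (Fin q) F) = trans F x := by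
  rw [trans, trans, ← ι_embG h]
  refine congrArg (ι F q p') ?_
  rw [embG, SemidirectProduct.map_inl]
  rfl

variable {q : ℕ}

theorem ι_inr_mem {p : ℕ} (k : K F p) : ι F q p (SemidirectProduct.inr k) ∈ KInf F q :=
  (mem_KInf_iff F q _).2 ⟨p, k, rfl⟩

namespace IsBiinvariant

variable {φ : GInf F q → ℂ}

theorem mul_left (hφ : IsBiinvariant φ) {k : GInf F q} (hk : k ∈ KInf F q) (g : GInf F q) :
    φ (k * g) = φ g := by
  simpa using hφ k hk 1 (one_mem _) g

theorem mul_right (hφ : IsBiinvariant φ) {k : GInf F q} (hk : k ∈ KInf F q) (g : GInf F q) :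
    φ (g * k) = φ g := by
  simpa using hφ 1 (one_mem _) k hk g

theorem apply_ι (hφ : IsBiinvariant φ) {p : ℕ} (g : G F p q) :
    φ (ι F q p g) = φ (trans F g.left.toAdd) := by
  conv_lhs => rw [← SemidirectProduct.inl_left_mul_inr_right g, map_mul]
  exact hφ.mul_right (ι_inr_mem _) _

/-- Conjugating the translation by `x` with `u` gives the translation by `u x`. -/
theorem trans_unitary_mul (hφ : IsBiinvariant φ) {p : ℕ} (u : K F p)
    (x : Matrix (Fin p) (Fin q) F) :
    φ (trans F ((u : Matrix (Fin p) (Fin p) F) * x)) = φ (trans F x) := by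
  have h : trans F ((u : Matrix (Fin p) (Fin p) F) * x) =
      ι F q p (SemidirectProduct.inr u) * trans F x * ι F q p (SemidirectProduct.inr u⁻¹) := by
    rw [trans, trans, ← map_mul, ← map_mul]
    exact congrArg _ (SemidirectProduct.inl_aut (φ := act F p q) u (Multiplicative.ofAdd x))
  rw [h]
  exact hφ _ (ι_inr_mem _) _ (ι_inr_mem _) _

/-- A biinvariant function depends on `(x, u)` only through `x^* x`. -/
theorem trans_congr (hφ : IsBiinvariant φ) {m n : ℕ} {x : Matrix (Fin m) (Fin q) F}
    {y : Matrix (Fin n) (Fin q) F} (h : xᴴ * x = yᴴ * y) : φ (trans F x) = φ (trans F y) := by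
  have key : ∀ {p : ℕ} {x y : Matrix (Fin p) (Fin q) F}, xᴴ * x = yᴴ * y →
      φ (trans F x) = φ (trans F y) := by
    intro p x y h
    obtain ⟨c, r, hc, hr, h1, h2, h3, h4, h5⟩ := exists_fourthRoot x
    have ha : (c ^ 2)ᴴ = c ^ 2 := by rw [conjTranspose_pow, hc]
    obtain ⟨U, hU⟩ := exists_unitary_mul_extM x hr ha h1 h2 h3 h4 h5
    -- The root and pseudo-inverse depend only on the Gram matrix, so those found for `x` also serve
    -- `y`.
    rw [h] at h1 h2
    obtain ⟨W, hW⟩ := exists_unitary_mul_extM y hr ha h1 h2 h3 h4 h5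
    rw [← trans_extM (Nat.le_add_right p q) x, ← trans_extM (Nat.le_add_right p q) y,
      ← hφ.trans_unitary_mul U, ← hφ.trans_unitary_mul W (extM y), hU, hW]
  rw [← trans_extM (le_max_left m n) x, ← trans_extM (le_max_right m n) y]
  refine key ?_
  rw [conjTranspose_extM_mul_extM (le_max_left m n), conjTranspose_extM_mul_extM (le_max_right m n),
    h]

end IsBiinvariant

/-- The matrices `x^* x` with `x ∈ M_{p,q}` for some `p`. -/
def IsGram (s : Matrix (Fin q) (Fin q) F) : Prop :=
  ∃ (p : ℕ) (x : Matrix (Fin p) (Fin q) F), xᴴ * x = s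

theorem isGram_conjTranspose_mul_self {p : ℕ} (x : Matrix (Fin p) (Fin q) F) : IsGram (xᴴ * x) :=
  ⟨p, x, rfl⟩

/-- Stacking matrices adds their Gram matrices, and the number of rows is unrestricted. -/
theorem IsGram.add {s t : Matrix (Fin q) (Fin q) F} (hs : IsGram s) (ht : IsGram t) :
    IsGram (s + t) := by
  obtain ⟨m, x, rfl⟩ := hs
  obtain ⟨n, y, rfl⟩ := ht
  exact ⟨m + n, stack x y, conjTranspose_stack_mul_stack x x y y⟩

theorem H.conjTranspose_coe (a : H F q) :
    (a : Matrix (Fin q) (Fin q) F)ᴴ = (a : Matrix (Fin q) (Fin q) F) := a.2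

theorem isGram_sq (a : H F q) : IsGram ((a : Matrix (Fin q) (Fin q) F) ^ 2) :=
  ⟨q, a, by rw [H.conjTranspose_coe, sq]⟩

/-- A Gram matrix has a square root in the cone `Π_q`. -/
theorem IsGram.exists_posCone {s : Matrix (Fin q) (Fin q) F} (hs : IsGram s) :
    ∃ a ∈ posCone F q, (a : Matrix (Fin q) (Fin q) F) ^ 2 = s := by
  obtain ⟨p, x, rfl⟩ := hs
  obtain ⟨c, -, hc, -, h, -⟩ := exists_fourthRoot x
  refine ⟨(⟨c, hc⟩ : H F q) ^ 2, ⟨⟨c, hc⟩, rfl⟩, ?_⟩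
  rw [sq, ← h]; rfl

open Classical in
/-- The function `s ↦ φ (x, 1)`, `s = x^* x`, on Gram matrices. -/
def profile (φ : GInf F q → ℂ) (s : Matrix (Fin q) (Fin q) F) : ℂ :=
  if h : IsGram s then φ (trans F h.choose_spec.choose) else 0

theorem IsBiinvariant.profile_eq {φ : GInf F q → ℂ} (hφ : IsBiinvariant φ) {p : ℕ}
    (x : Matrix (Fin p) (Fin q) F) : profile φ (xᴴ * x) = φ (trans F x) := by
  have h := isGram_conjTranspose_mul_self x
  rw [profile, dif_pos h]
  exact hφ.trans_congr h.choose_spec.choose_spec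

theorem IsBiinvariant.profile_sq {φ : GInf F q → ℂ} (hφ : IsBiinvariant φ) (a : H F q) :
    profile φ ((a : Matrix (Fin q) (Fin q) F) ^ 2) = φ (gOf a) := by
  rw [sq]
  nth_rewrite 1 [← H.conjTranspose_coe a]
  exact hφ.profile_eq _

/-! ### Second moments of the entries of a Haar distributed unitary matrix -/

theorem sum_norm_entry_sq {p : ℕ} (u : K F p) (j : Fin p) :
    ∑ i, ‖(u : Matrix (Fin p) (Fin p) F) i j‖ ^ 2 = 1 := by
  have h : ((u : Matrix (Fin p) (Fin p) F)ᴴ * (u : Matrix (Fin p) (Fin p) F)) j j = 1 := by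
    rw [← star_eq_conjTranspose, Unitary.coe_star_mul_self, one_apply_eq]
  rw [conjTranspose_mul_self_apply, ← map_one (algebraMap ℝ F)] at h
  exact (algebraMap ℝ F).injective h

theorem continuous_entry {p : ℕ} (i j : Fin p) :
    Continuous fun u : K F p => (u : Matrix (Fin p) (Fin p) F) i j :=
  continuous_subtype_val.matrix_elem i j

theorem integrable_of_continuous {p : ℕ} {E : Type*} [NormedAddCommGroup E]
    [SecondCountableTopology E] {f : K F p → E} (hf : Continuous f) : Integrable f (haarK F p) := by
  borelize E
  obtain ⟨C, hC⟩ := isCompact_univ.exists_bound_of_continuousOn hf.continuousOn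
  exact Integrable.of_bound hf.measurable.aestronglyMeasurable C
    (Eventually.of_forall fun u => hC u (Set.mem_univ u))

variable (F) in
/-- Permutation matrices as elements of `K_p`. -/
def permK {p : ℕ} (σ : Equiv.Perm (Fin p)) : K F p :=
  ⟨σ.permMatrix F, by
    rw [Unitary.mem_iff, star_eq_conjTranspose, conjTranspose_permMatrix, ← permMatrix_mul,
      ← permMatrix_mul]
    simp⟩

theorem permK_mul_apply {p : ℕ} (σ : Equiv.Perm (Fin p)) (u : K F p) (i j : Fin p) :
    ((permK F σ * u : K F p) : Matrix (Fin p) (Fin p) F) i j =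
      (u : Matrix (Fin p) (Fin p) F) (σ i) j := by
  change (σ.permMatrix F * (u : Matrix (Fin p) (Fin p) F)) i j = _
  rw [Equiv.Perm.permMatrix, PEquiv.toMatrix_toPEquiv_mul]
  rfl

/-- Left translation by transpositions gives all `p` entries of a column the same second moment, and
their squared norms sum to 1. -/
theorem integral_norm_entry_sq {p : ℕ} (i j : Fin p) :
    ∫ u : K F p, ‖(u : Matrix (Fin p) (Fin p) F) i j‖ ^ 2 ∂haarK F p = (p : ℝ)⁻¹ := by
  have hint : ∀ l : Fin p, Integrable
      (fun u : K F p => ‖(u : Matrix (Fin p) (Fin p) F) l j‖ ^ 2) (haarK F p) := fun l =>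
    integrable_of_continuous ((continuous_entry l j).norm.pow 2)
  have hinv : ∀ l : Fin p, ∫ u : K F p, ‖(u : Matrix (Fin p) (Fin p) F) l j‖ ^ 2 ∂haarK F p =
      ∫ u : K F p, ‖(u : Matrix (Fin p) (Fin p) F) i j‖ ^ 2 ∂haarK F p := by
    intro l
    rw [← integral_mul_left_eq_self _ (permK F (Equiv.swap i l))]
    simp only [permK_mul_apply, Equiv.swap_apply_right]
  have hsum : ∑ l, ∫ u : K F p, ‖(u : Matrix (Fin p) (Fin p) F) l j‖ ^ 2 ∂haarK F p = 1 := by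
    rw [← integral_finsetSum _ fun l _ => hint l]
    simp [sum_norm_entry_sq]
  rw [Finset.sum_congr rfl fun l _ => hinv l, Finset.sum_const, Finset.card_univ, Fintype.card_fin,
    nsmul_eq_mul] at hsum
  exact eq_inv_of_mul_eq_one_right hsum

/-! ### The limit of the spherical averages -/

theorem continuous_trans {φ : GInf F q → ℂ} (hφ : Continuous φ) (p : ℕ) :
    Continuous fun x : Matrix (Fin p) (Fin q) F => φ (trans F x) := by
  refine ((continuous_GInf_iff F q φ).1 hφ p).comp (continuous_induced_rng.2 ?_)
  exact continuous_id.prodMk continuous_const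

/-- The Gram matrix of `x + k y`, where `B` is the relevant corner of the unitary matrix `k`. -/
def gramSum {m : ℕ} (x y : Matrix (Fin m) (Fin q) F) (B : Matrix (Fin m) (Fin m) F) :
    Matrix (Fin q) (Fin q) F :=
  xᴴ * x + yᴴ * y + (xᴴ * B * y + (xᴴ * B * y)ᴴ)

theorem continuous_gramSum {m : ℕ} (x y : Matrix (Fin m) (Fin q) F) :
    Continuous (gramSum x y) := by
  have h : Continuous fun B : Matrix (Fin m) (Fin m) F => xᴴ * B * y :=
    (continuous_const.matrix_mul continuous_id).matrix_mul continuous_const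
  exact continuous_const.add (h.add h.matrix_conjTranspose)

theorem isCompact_setOf_norm_entry_le (m n : ℕ) (R : ℝ) :
    IsCompact {B : Matrix (Fin m) (Fin n) F | ∀ i j, ‖B i j‖ ≤ R} := by
  have : FiniteDimensional ℝ F := RCH.finiteDimensional
  have : ProperSpace F := FiniteDimensional.proper ℝ F
  have h : IsCompact (Set.univ.pi fun _ : Fin m => Set.univ.pi fun _ : Fin n =>
      Metric.closedBall (0 : F) R) :=
    isCompact_univ_pi fun _ => isCompact_univ_pi fun _ => isCompact_closedBall 0 R
  refine (congrArg IsCompact (Set.ext fun B => ?_)).mpr h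
  refine Iff.trans ?_ (Set.mem_univ_pi (f := B)).symm
  refine forall_congr' fun i => Iff.trans ?_ (Set.mem_univ_pi (f := B i)).symm
  exact forall_congr' fun j => mem_closedBall_zero_iff.symm

/-- The pairs `(w, B)` with `w^* w = gramSum x y B` and entries of `B` in the unit ball. -/
def gramPairs {m : ℕ} (x y : Matrix (Fin m) (Fin q) F) :
    Set (Matrix (Fin q) (Fin q) F × Matrix (Fin m) (Fin m) F) :=
  {z | z.1ᴴ * z.1 = gramSum x y z.2 ∧ ∀ i j, ‖z.2 i j‖ ≤ 1}

/-- The diagonal of `wᴴ * w` holds the squared column norms of `w`, and that of `gramSum x y B` is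
bounded while `B` stays in the box. -/
theorem isCompact_gramPairs {m : ℕ} (x y : Matrix (Fin m) (Fin q) F) :
    IsCompact (gramPairs x y) := by
  have hbox := isCompact_setOf_norm_entry_le (F := F) m m 1
  obtain ⟨R, hR⟩ := hbox.exists_bound_of_continuousOn
    (f := fun B => ∑ j, ‖gramSum x y B j j‖)
    (continuous_finsetSum _ fun j _ =>
      ((continuous_gramSum x y).matrix_elem j j).norm).continuousOn
  refine ((isCompact_setOf_norm_entry_le (F := F) q q (R + 1)).prod hbox).of_isClosed_subset
    (IsClosed.inter (isClosed_eq ?_ ?_) ?_) ?_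
  · exact continuous_fst.matrix_conjTranspose.matrix_mul continuous_fst
  · exact (continuous_gramSum x y).comp continuous_snd
  · exact hbox.isClosed.preimage continuous_snd
  · rintro ⟨w, B⟩ ⟨hw, hB⟩
    refine ⟨fun i j => ?_, hB⟩
    have h1 : ‖w i j‖ ^ 2 ≤ R := by
      calc ‖w i j‖ ^ 2 ≤ ∑ l, ‖w l j‖ ^ 2 :=
            Finset.single_le_sum (f := fun l => ‖w l j‖ ^ 2) (fun _ _ => sq_nonneg _)
              (Finset.mem_univ i)
        _ = ‖gramSum x y B j j‖ := by
            rw [← hw, conjTranspose_mul_self_apply, norm_algebraMap', Real.norm_of_nonneg]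
            positivity
        _ ≤ ∑ l, ‖gramSum x y B l l‖ :=
            Finset.single_le_sum (f := fun l => ‖gramSum x y B l l‖) (fun _ _ => norm_nonneg _)
              (Finset.mem_univ j)
        _ ≤ R := (le_abs_self _).trans (hR B hB)
    change ‖w i j‖ ≤ R + 1
    -- From `2 t ≤ t ^ 2 + 1 ≤ R + 1`.
    nlinarith [sq_nonneg (‖w i j‖ - 1)]

theorem gramSum_zero {m : ℕ} (x y : Matrix (Fin m) (Fin q) F) :
    gramSum x y 0 = xᴴ * x + yᴴ * y := by simp [gramSum]

/-- Compactness replaces any continuity of the square root: the left side vanishes where `B = 0`,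
and where `B ≠ 0` a large `n` suffices, so increasing open sets cover `gramPairs x y` and one of
them contains it. The bound is linear in the squared entries of `B` so that it can be integrated. -/
theorem IsBiinvariant.exists_bound {φ : GInf F q → ℂ} (hφ : IsBiinvariant φ) (hc : Continuous φ)
    {m : ℕ} (x y : Matrix (Fin m) (Fin q) F) {ε : ℝ} (hε : 0 < ε) :
    ∃ n : ℕ, ∀ (w : Matrix (Fin q) (Fin q) F) (B : Matrix (Fin m) (Fin m) F),
      wᴴ * w = gramSum x y B → (∀ i j, ‖B i j‖ ≤ 1) →
      ‖φ (trans F w) - profile φ (xᴴ * x + yᴴ * y)‖ < ε + n * ∑ i, ∑ j, ‖B i j‖ ^ 2 := by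
  have hlhs : Continuous fun z : Matrix (Fin q) (Fin q) F × Matrix (Fin m) (Fin m) F =>
      ‖φ (trans F z.1) - profile φ (xᴴ * x + yᴴ * y)‖ :=
    (((continuous_trans hc q).comp continuous_fst).sub continuous_const).norm
  have hsum : Continuous fun z : Matrix (Fin q) (Fin q) F × Matrix (Fin m) (Fin m) F =>
      ∑ i, ∑ j, ‖z.2 i j‖ ^ 2 :=
    continuous_finsetSum _ fun i _ => continuous_finsetSum _ fun j _ =>
      (continuous_snd.matrix_elem i j).norm.pow 2
  let U : ℕ → Set (Matrix (Fin q) (Fin q) F × Matrix (Fin m) (Fin m) F) := fun n =>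
    {z | ‖φ (trans F z.1) - profile φ (xᴴ * x + yᴴ * y)‖ < ε + n * ∑ i, ∑ j, ‖z.2 i j‖ ^ 2}
  suffices h : ∃ n, gramPairs x y ⊆ U n from
    h.imp fun n hn w B hw hB => @hn (w, B) ⟨hw, hB⟩
  refine (isCompact_gramPairs x y).elim_directed_cover U
    (fun n => isOpen_lt hlhs (continuous_const.add (continuous_const.mul hsum))) ?_ ?_
  · rintro ⟨w, B⟩ ⟨hw, -⟩
    rw [Set.mem_iUnion]
    by_cases hB : B = 0
    · refine ⟨0, ?_⟩
      subst hB
      have : φ (trans F w) = profile φ (xᴴ * x + yᴴ * y) := by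
        rw [← gramSum_zero, ← hφ.profile_eq]
        exact congrArg _ hw
      simpa [U, this] using hε
    · have hpos : 0 < ∑ i, ∑ j, ‖B i j‖ ^ 2 := by
        rw [Finset.sum_comm, ← traceForm_self]
        exact (traceForm_self_nonneg B).lt_of_ne fun h => hB (traceForm_self_eq_zero h.symm)
      obtain ⟨n, hn⟩ := exists_nat_gt
        (‖φ (trans F w) - profile φ (xᴴ * x + yᴴ * y)‖ / ∑ i, ∑ j, ‖B i j‖ ^ 2)
      exact ⟨n, ((div_lt_iff₀ hpos).1 hn).trans (lt_add_of_pos_left _ hε)⟩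
  · refine Monotone.directed_le fun n n' h z hz => ?_
    refine lt_of_lt_of_le (Set.mem_ofPred_eq ▸ hz : _ < _) (?_ : _ ≤ ε + n' * _)
    have : (n : ℝ) ≤ n' := by exact_mod_cast h
    gcongr

theorem conjTranspose_extM_mul_mul_extM {m p : ℕ} (h : m ≤ p) (x y : Matrix (Fin m) (Fin q) F)
    (k : Matrix (Fin p) (Fin p) F) :
    (extM x : Matrix (Fin p) (Fin q) F)ᴴ * k * (extM y : Matrix (Fin p) (Fin q) F) =
      xᴴ * k.submatrix (Fin.castLE h) (Fin.castLE h) * y := by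
  ext i j
  rw [Matrix.mul_apply, sum_castLE h, Matrix.mul_apply]
  · refine Finset.sum_congr rfl fun l _ => ?_
    rw [Matrix.mul_apply, sum_castLE h, Matrix.mul_apply]
    · simp [extM]
    · intro l' hl'
      simp [extM, hl']
  · intro l hl
    simp [extM, hl]

theorem conjTranspose_add_mul_self {m p : ℕ} (h : m ≤ p) (x y : Matrix (Fin m) (Fin q) F)
    (k : K F p) :
    ((extM x : Matrix (Fin p) (Fin q) F) +
        (k : Matrix (Fin p) (Fin p) F) * (extM y : Matrix (Fin p) (Fin q) F))ᴴ *
      ((extM x : Matrix (Fin p) (Fin q) F) +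
        (k : Matrix (Fin p) (Fin p) F) * (extM y : Matrix (Fin p) (Fin q) F)) =
      gramSum x y ((k : Matrix (Fin p) (Fin p) F).submatrix (Fin.castLE h) (Fin.castLE h)) := by
  have hk : (k : Matrix (Fin p) (Fin p) F)ᴴ * (k : Matrix (Fin p) (Fin p) F) = 1 := by
    rw [← star_eq_conjTranspose, Unitary.coe_star_mul_self]
  rw [gramSum, ← conjTranspose_extM_mul_mul_extM h, ← conjTranspose_extM_mul_extM h x,
    ← conjTranspose_extM_mul_extM h y]
  set X := (extM x : Matrix (Fin p) (Fin q) F)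
  set Y := (extM y : Matrix (Fin p) (Fin q) F)
  have h2 : (k.1 * Y)ᴴ * (k.1 * Y) = Yᴴ * Y := by
    rw [conjTranspose_mul, Matrix.mul_assoc, ← Matrix.mul_assoc _ k.1, hk, Matrix.one_mul]
  rw [conjTranspose_add, Matrix.add_mul, Matrix.mul_add, Matrix.mul_add, h2, conjTranspose_mul,
    conjTranspose_mul, conjTranspose_mul, conjTranspose_conjTranspose, Matrix.mul_assoc,
    Matrix.mul_assoc]
  abel

theorem IsBiinvariant.apply_mul_mul {φ : GInf F q → ℂ} (hφ : IsBiinvariant φ) {m p : ℕ} (h : m ≤ p)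
    (x y : Matrix (Fin m) (Fin q) F) (k : K F p) :
    φ (trans F x * ι F q p (SemidirectProduct.inr k) * trans F y) =
      φ (trans F ((extM x : Matrix (Fin p) (Fin q) F) +
        (k : Matrix (Fin p) (Fin p) F) * (extM y : Matrix (Fin p) (Fin q) F))) := by
  rw [← trans_extM h x, ← trans_extM h y]
  rw [trans, trans, ← map_mul, ← map_mul, hφ.apply_ι]
  refine congrArg (fun z => φ (trans F z)) ?_
  change (extM x : Matrix (Fin p) (Fin q) F) +
    ((1 : K F p) : Matrix (Fin p) (Fin p) F) * (0 : Matrix (Fin p) (Fin q) F) +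
    ((1 * k : K F p) : Matrix (Fin p) (Fin p) F) * (extM y : Matrix (Fin p) (Fin q) F) = _
  rw [Matrix.mul_zero, add_zero, one_mul]

theorem continuous_apply_mul_mul {φ : GInf F q → ℂ} (hφ : IsBiinvariant φ) (hc : Continuous φ)
    {m p : ℕ} (h : m ≤ p) (x y : Matrix (Fin m) (Fin q) F) :
    Continuous fun k : K F p => φ (trans F x * ι F q p (SemidirectProduct.inr k) * trans F y) := by
  simp only [hφ.apply_mul_mul h]
  exact (continuous_trans hc p).comp
    (continuous_const.add (continuous_subtype_val.matrix_mul continuous_const))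

theorem IsBiinvariant.tendsto_integral_trans {φ : GInf F q → ℂ} (hφ : IsBiinvariant φ)
    (hc : Continuous φ) {m : ℕ} (x y : Matrix (Fin m) (Fin q) F) :
    Tendsto (fun p => ∫ k : K F p,
        φ (trans F x * ι F q p (SemidirectProduct.inr k) * trans F y) ∂haarK F p)
      atTop (𝓝 (profile φ (xᴴ * x + yᴴ * y))) := by
  rw [Metric.tendsto_atTop']
  intro ε hε
  obtain ⟨n, hn⟩ := hφ.exists_bound hc x y (half_pos hε)
  -- The `m * m` corner entries have total second moment `m * m / p`; for `p > N` its multiple by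
  -- `n` is below `ε / 2`.
  obtain ⟨N, hN⟩ := exists_nat_gt (n * (m * m) / (ε / 2) : ℝ)
  refine ⟨max m N, fun p hp => ?_⟩
  have hmp : m ≤ p := (le_max_left m N).trans hp.le
  have hNp : (N : ℝ) ≤ p := by exact_mod_cast (le_max_right m N).trans hp.le
  have hp0 : (0 : ℝ) < p := by exact_mod_cast (Nat.zero_le _).trans_lt hp
  set c := profile φ (xᴴ * x + yᴴ * y)
  let e : Fin m → Fin p := Fin.castLE hmp
  have hterm : ∀ i j, Integrable (fun k : K F p => ‖(k : Matrix (Fin p) (Fin p) F) (e i) (e j)‖ ^ 2)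
      (haarK F p) := fun i j => integrable_of_continuous ((continuous_entry _ _).norm.pow 2)
  have hpt : ∀ k : K F p,
      ‖φ (trans F x * ι F q p (SemidirectProduct.inr k) * trans F y) - c‖ ≤
        ε / 2 + n * ∑ i, ∑ j, ‖(k : Matrix (Fin p) (Fin p) F) (e i) (e j)‖ ^ 2 := by
    intro k
    rw [hφ.apply_mul_mul hmp]
    have hg := conjTranspose_add_mul_self hmp x y k
    -- Trade the `p × q` matrix `x + k y` for the `q × q` root of its Gram matrix, which lies in a
    -- compact set independent of `p`.
    obtain ⟨a, -, ha⟩ := (isGram_conjTranspose_mul_self ((extM x : Matrix (Fin p) (Fin q) F) +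
        (k : Matrix (Fin p) (Fin p) F) * (extM y : Matrix (Fin p) (Fin q) F))).exists_posCone
    have ha' := (congrArg (· * (a : Matrix (Fin q) (Fin q) F)) (H.conjTranspose_coe a)).trans
      ((sq _).symm.trans ha)
    rw [← hφ.trans_congr ha']
    exact (hn _ _ (ha'.trans hg) fun i j => norm_entry_le_one k _ _).le
  have hint := integrable_of_continuous (continuous_apply_mul_mul hφ hc hmp x y)
  have hbint : Integrable (fun k : K F p => ∑ i, ∑ j,
      ‖(k : Matrix (Fin p) (Fin p) F) (e i) (e j)‖ ^ 2) (haarK F p) :=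
    integrable_finsetSum _ fun i _ => integrable_finsetSum _ fun j _ => hterm i j
  have hmoment : ∫ k : K F p, ∑ i, ∑ j, ‖(k : Matrix (Fin p) (Fin p) F) (e i) (e j)‖ ^ 2
      ∂haarK F p = m * m * (p : ℝ)⁻¹ := by
    rw [integral_finsetSum _ fun i _ => integrable_finsetSum _ fun j _ => hterm i j]
    simp_rw [integral_finsetSum _ fun j _ => hterm _ j, integral_norm_entry_sq]
    simp [mul_assoc]
  have hle := norm_integral_le_of_norm_le ((integrable_const (ε / 2)).add (hbint.const_mul (n : ℝ)))
    (Eventually.of_forall hpt)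
  rw [integral_sub hint (integrable_const c), integral_const] at hle
  simp only [Pi.add_apply] at hle
  rw [integral_add (integrable_const _) (hbint.const_mul _), integral_const_mul, hmoment] at hle
  simp only [probReal_univ, one_smul, integral_const] at hle
  rw [dist_eq_norm]
  refine hle.trans_lt ?_
  have h1 : (n * (m * m) / (ε / 2) : ℝ) < p := hN.trans_le hNp
  rw [div_lt_iff₀ (half_pos hε)] at h1
  have h2 : (n * (m * m * (p : ℝ)⁻¹) : ℝ) < ε / 2 := by
    rw [← mul_assoc, ← div_eq_mul_inv, div_lt_iff₀ hp0]
    linarith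
  linarith

/-- Every element of `G_p` lies in the double coset of a translation on either side. -/
theorem ι_eq_mul_trans {p : ℕ} (g : G F p q) :
    ∃ x : Matrix (Fin p) (Fin q) F,
      ι F q p g = ι F q p (SemidirectProduct.inr g.right) * trans F x := by
  refine ⟨((g.right⁻¹ : K F p) : Matrix (Fin p) (Fin p) F) * g.left.toAdd, ?_⟩
  rw [trans, ← map_mul]
  refine congrArg _ (SemidirectProduct.ext (Multiplicative.toAdd.injective ?_) (mul_one _).symm)
  change g.left.toAdd = (0 : Matrix (Fin p) (Fin q) F) + (g.right : Matrix (Fin p) (Fin p) F) *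
    (((g.right⁻¹ : K F p) : Matrix (Fin p) (Fin p) F) * g.left.toAdd)
  rw [zero_add, ← Matrix.mul_assoc]
  exact (congrArg (· * g.left.toAdd) (Unitary.coe_mul_star_self g.right)).trans
    (Matrix.one_mul _) |>.symm

theorem ι_eq_trans_mul {p : ℕ} (g : G F p q) :
    ι F q p g = trans F g.left.toAdd * ι F q p (SemidirectProduct.inr g.right) := by
  rw [trans, ← map_mul]
  exact congrArg _ (SemidirectProduct.inl_left_mul_inr_right g).symm

/-- A continuous biinvariant function is spherical if and only if its profile is a nonzero
multiplicative function of Gram matrices. -/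
theorem IsBiinvariant.isOlshanskiSpherical_iff {φ : GInf F q → ℂ} (hφ : IsBiinvariant φ)
    (hc : Continuous φ) :
    IsOlshanskiSpherical φ ↔ (∃ s, IsGram s ∧ profile φ s ≠ 0) ∧
      ∀ s t, IsGram s → IsGram t → profile φ (s + t) = profile φ s * profile φ t := by
  constructor
  · intro h
    constructor
    · obtain ⟨g, hg⟩ := Function.ne_iff.1 h.ne_zero
      induction g using DirectLimit.induction with
      | _ p g =>
        refine ⟨_, isGram_conjTranspose_mul_self g.left.toAdd, ?_⟩
        rw [hφ.profile_eq, ← hφ.apply_ι]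
        exact hg
    · rintro s t hs ht
      obtain ⟨a, -, rfl⟩ := hs.exists_posCone
      obtain ⟨b, -, rfl⟩ := ht.exists_posCone
      rw [hφ.profile_sq, hφ.profile_sq]
      refine tendsto_nhds_unique ?_ (h.product_formula (gOf a) (gOf b))
      have := hφ.tendsto_integral_trans hc (a : Matrix (Fin q) (Fin q) F) b
      rwa [H.conjTranspose_coe, H.conjTranspose_coe, ← sq, ← sq] at this
  · rintro ⟨⟨s, hs, hs0⟩, hmul⟩
    refine ⟨?_, hc, hφ, fun g h => ?_⟩
    · rintro rfl
      obtain ⟨p, x, rfl⟩ := hs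
      exact hs0 (hφ.profile_eq x)
    · obtain ⟨p, g, h, rfl, rfl⟩ := DirectLimit.exists_eq_mk₂ (embG F q) g h
      change Tendsto (fun p' => ∫ k : K F p', φ (ι F q p g * _ * ι F q p h) ∂haarK F p') atTop
        (𝓝 (φ (ι F q p g) * φ (ι F q p h)))
      -- Put the unitary part of `g` on the left and that of `h` on the right: both are then
      -- outermost and biinvariance removes them.
      obtain ⟨x, hx⟩ := ι_eq_mul_trans g
      rw [hx, ι_eq_trans_mul h, hφ.mul_left (ι_inr_mem _), hφ.mul_right (ι_inr_mem _)]
      have hcoset : ∀ l r k : GInf F q, l ∈ KInf F q → r ∈ KInf F q →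
          φ (l * trans F x * k * (trans F h.left.toAdd * r)) =
            φ (trans F x * k * trans F h.left.toAdd) := by
        intro l r k hl hr
        rw [← hφ l hl r hr (trans F x * k * trans F h.left.toAdd)]
        simp only [mul_assoc]
      simp only [hcoset _ _ _ (ι_inr_mem g.right) (ι_inr_mem h.right)]
      rw [← hφ.profile_eq, ← hφ.profile_eq, ← hmul _ _ (isGram_conjTranspose_mul_self _)
        (isGram_conjTranspose_mul_self _)]
      exact hφ.tendsto_integral_trans hc _ _

/-! ### Continuous exponential functions -/

/-- Since `g t * ∫₀ˣ g` is the integral of `g` from `t` to `t + x`, choosing `x` with `∫₀ˣ g ≠ 0`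
shows `g` differentiable, and then `g' = c g`. -/
theorem exists_eq_exp_of_continuous {g : ℝ → ℂ} (hg : Continuous g) (h0 : g 0 = 1)
    (hadd : ∀ s t, g (s + t) = g s * g t) : ∃ c : ℂ, ∀ t : ℝ, g t = Complex.exp (t * c) := by
  have hI : ∀ t, HasDerivAt (fun x => ∫ u in (0 : ℝ)..x, g u) (g t) t := fun t =>
    intervalIntegral.integral_hasDerivAt_right (hg.intervalIntegrable _ _)
      (hg.stronglyMeasurableAtFilter _ _) hg.continuousAt
  obtain ⟨x, hx⟩ : ∃ x, ∫ u in (0 : ℝ)..x, g u ≠ 0 := by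
    by_contra! h
    have h1 := hI 0
    rw [funext h, h0] at h1
    exact zero_ne_one ((hasDerivAt_const (0 : ℝ) (0 : ℂ)).unique h1)
  have hshift : ∀ t, g t = ((∫ u in (0 : ℝ)..(t + x), g u) - ∫ u in (0 : ℝ)..t, g u) /
      ∫ u in (0 : ℝ)..x, g u := by
    intro t
    rw [eq_div_iff hx, intervalIntegral.integral_interval_sub_left (hg.intervalIntegrable _ _)
      (hg.intervalIntegrable _ _), ← intervalIntegral.integral_const_mul]
    simp_rw [← hadd]
    rw [intervalIntegral.integral_comp_add_left (fun u => g u), add_zero]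
  obtain ⟨c, hc⟩ : ∃ c, HasDerivAt g c 0 := by
    have h := (((hI (0 + x)).comp_add_const 0 x).sub (hI 0)).div_const
      (∫ u in (0 : ℝ)..x, g u)
    exact ⟨_, h.congr_of_eventuallyEq (Eventually.of_forall hshift)⟩
  have hg' : ∀ t, HasDerivAt g (g t * c) t := by
    intro t
    have h1 : HasDerivAt (fun s => g t * g (s - t)) (g t * c) t := by
      refine HasDerivAt.const_mul _ (HasDerivAt.comp_sub_const t t ?_)
      rwa [sub_self]
    refine h1.congr_of_eventuallyEq (Eventually.of_forall fun s => ?_)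
    change g s = g t * g (s - t)
    rw [← hadd, add_sub_cancel]
  refine ⟨c, fun t => ?_⟩
  have hexp : ∀ t : ℝ, HasDerivAt (fun s : ℝ => Complex.exp (-(s * c)))
      (Complex.exp (-(t * c)) * -c) t := fun t => by
    simpa using ((Complex.ofRealCLM.hasDerivAt (x := t)).mul_const c).neg.cexp
  have hprod : ∀ t : ℝ, HasDerivAt (fun s : ℝ => g s * Complex.exp (-(s * c))) 0 t := fun t =>
    ((hg' t).mul (hexp t)).congr_deriv (by ring)
  have hconst := is_const_of_deriv_eq_zero (fun t => (hprod t).differentiableAt)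
    (fun t => (hprod t).deriv) t 0
  simp only [Complex.ofReal_zero, zero_mul, neg_zero, Complex.exp_zero, mul_one, h0] at hconst
  rwa [Complex.exp_neg, ← div_eq_mul_inv, div_eq_one_iff_eq (Complex.exp_ne_zero _)] at hconst

/-- Compare derivatives at `t = 0`; this removes the `2πi` ambiguity of a logarithm. -/
theorem eq_of_forall_exp_mul_eq {c d : ℂ}
    (h : ∀ t : ℝ, Complex.exp (t * c) = Complex.exp (t * d)) : c = d := by
  have hexp : ∀ c : ℂ, HasDerivAt (fun s : ℝ => Complex.exp (s * c)) c 0 := fun c => by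
    simpa using ((Complex.ofRealCLM.hasDerivAt (x := 0)).mul_const c).cexp
  have hc := hexp c
  rw [funext h] at hc
  exact hc.unique (hexp d)

/-- A homomorphism from a real vector space to `ℂ^×` which is continuous on lines is the
exponential of a linear functional. -/
theorem exists_linearMap_eq_exp {V : Type*} [AddCommGroup V] [Module ℝ V] {f : V → ℂ}
    (hf : ∀ v, Continuous fun t : ℝ => f (t • v)) (h0 : f 0 = 1)
    (hadd : ∀ v w, f (v + w) = f v * f w) :
    ∃ L : V →ₗ[ℝ] ℂ, ∀ v, f v = Complex.exp (L v) := by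
  have hline : ∀ v, ∃ c : ℂ, ∀ t : ℝ, f (t • v) = Complex.exp (t * c) := fun v =>
    exists_eq_exp_of_continuous (hf v) (by rw [zero_smul, h0]) fun s t => by rw [add_smul, hadd]
  choose L hL using hline
  -- The exponent on each line is unique, which forces additivity and homogeneity.
  refine ⟨{ toFun := L, map_add' := fun v w => ?_, map_smul' := fun r v => ?_ }, fun v => ?_⟩
  · refine eq_of_forall_exp_mul_eq fun t => ?_
    rw [← hL, smul_add, hadd, hL, hL, mul_add, Complex.exp_add]
  · refine eq_of_forall_exp_mul_eq fun t => ?_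
    rw [← hL, smul_smul, hL, RingHom.id_apply, Complex.real_smul, Complex.ofReal_mul, mul_assoc]
  · simpa using hL v 1

/-! ### Linear functionals on Hermitian matrices -/

theorem scalar_eq_traceForm (x y : H F q) :
    scalar x y = traceForm (x : Matrix (Fin q) (Fin q) F) (y : Matrix (Fin q) (Fin q) F) := by
  rw [traceForm, H.conjTranspose_coe]; rfl

variable (F q) in
/-- The Euclidean scalar product of `H_q` as a bilinear form. -/
def scalarForm : H F q →ₗ[ℝ] H F q →ₗ[ℝ] ℝ :=
  LinearMap.mk₂ ℝ (fun y x => scalar x y)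
    (fun y y' x => by simp [scalar, RCH.re_eq, Matrix.mul_add])
    (fun r y x => by simp [scalar, RCH.re_eq])
    (fun y x x' => by simp [scalar, RCH.re_eq, Matrix.add_mul])
    (fun r y x => by simp [scalar, RCH.re_eq])

theorem scalarForm_apply (x y : H F q) : scalarForm F q y x = scalar x y := rfl

instance instFiniteDimensionalH : FiniteDimensional ℝ (H F q) := by
  have : FiniteDimensional ℝ F := RCH.finiteDimensional
  let e : H F q →ₗ[ℝ] Matrix (Fin q) (Fin q) F :=
    { toFun := Subtype.val, map_add' := fun _ _ => rfl, map_smul' := fun _ _ => rfl }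
  exact FiniteDimensional.of_injective e Subtype.val_injective

instance instContinuousSMulH : ContinuousSMul ℝ (H F q) :=
  ⟨continuous_induced_rng.2 (continuous_fst.smul (continuous_subtype_val.comp continuous_snd))⟩

/-- The form is definite, so `y ↦ ⟨·, y⟩` is injective into a dual of equal dimension. -/
theorem exists_scalar_eq (ℓ : H F q →ₗ[ℝ] ℝ) : ∃ b : H F q, ∀ x, ℓ x = scalar x b := by
  have hinj : Function.Injective (scalarForm F q) := by
    rw [← LinearMap.ker_eq_bot, LinearMap.ker_eq_bot']
    intro y hy
    have h : scalar y y = 0 := by rw [← scalarForm_apply, hy]; rfl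
    rw [scalar_eq_traceForm] at h
    exact Subtype.ext (traceForm_self_eq_zero h)
  obtain ⟨b, hb⟩ := (LinearMap.injective_iff_surjective_of_finrank_eq_finrank
    (Subspace.dual_finrank_eq (K := ℝ) (V := H F q)).symm).1 hinj ℓ
  exact ⟨b, fun x => by rw [← hb, scalarForm_apply]⟩

theorem psi_eq (b : HC F q) (a : H F q) :
    psi b a = Complex.exp (-((scalar (a ^ 2) b.re : ℂ) + scalar (a ^ 2) b.im * Complex.I)) := by
  simp [psi, HC.scalar, HC.ofReal, ← scalarForm_apply]

/-! ### The theorem over each of the three division algebras -/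

variable {φ : GInf F q → ℂ}

/-- The profile of a spherical function is the exponential of a linear functional. -/
theorem IsBiinvariant.exists_linearMap (hφ : IsBiinvariant φ) (hc : Continuous φ)
    (hne : ∃ s, IsGram s ∧ profile φ s ≠ 0)
    (hmul : ∀ s t, IsGram s → IsGram t → profile φ (s + t) = profile φ s * profile φ t) :
    ∃ L : H F q →ₗ[ℝ] ℂ, ∀ a : H F q, φ (gOf a) = Complex.exp (L (a ^ 2)) := by
  have hzero : profile φ (0 : Matrix (Fin q) (Fin q) F) = 1 := by
    obtain ⟨s, hs, hs0⟩ := hne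
    have h := hmul s 0 hs ⟨0, 0, by simp⟩
    rw [add_zero] at h
    exact (mul_right_eq_self₀.1 h.symm).resolve_right hs0
  have hcont : Continuous fun a : H F q => φ (gOf a) :=
    (continuous_trans hc q).comp continuous_subtype_val
  have hquarter : ∀ a : H F q, φ (gOf a) = φ (gOf ((2⁻¹ : ℝ) • a)) ^ 4 := by
    intro a
    set b := (2⁻¹ : ℝ) • a with hb
    have ha : (a : Matrix (Fin q) (Fin q) F) ^ 2 =
        ((b : Matrix (Fin q) (Fin q) F) ^ 2 + (b : Matrix (Fin q) (Fin q) F) ^ 2) +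
        ((b : Matrix (Fin q) (Fin q) F) ^ 2 + (b : Matrix (Fin q) (Fin q) F) ^ 2) := by
      have : (a : Matrix (Fin q) (Fin q) F) = b + b := by
        rw [← AddSubgroup.coe_add, hb, ← add_smul]; norm_num
      rw [this]; noncomm_ring
    have h2 := (isGram_sq b).add (isGram_sq b)
    rw [← hφ.profile_sq a, ha, hmul _ _ h2 h2, hmul _ _ (isGram_sq b) (isGram_sq b),
      hφ.profile_sq]
    ring
  have hnz : ∀ a : H F q, φ (gOf a) ≠ 0 := by
    intro a ha
    -- A zero at `a` propagates to every `2⁻ⁿ a`, and continuity would make it a zero at `0`.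
    have hn : ∀ n : ℕ, φ (gOf (((2⁻¹ : ℝ) ^ n) • a)) = 0 := by
      intro n
      induction n with
      | zero => simpa using ha
      | succ n ih =>
        rw [hquarter, smul_smul, ← pow_succ'] at ih
        exact pow_eq_zero_iff (n := 4) (by norm_num) |>.1 ih
    have hlim : Tendsto (fun n : ℕ => φ (gOf (((2⁻¹ : ℝ) ^ n) • a))) atTop
        (𝓝 (φ (gOf ((0 : ℝ) • a)))) :=
      (hcont.tendsto _).comp
        ((tendsto_pow_atTop_nhds_zero_of_lt_one (by norm_num) (by norm_num)).smul_const a)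
    simp only [hn] at hlim
    have h0 := tendsto_nhds_unique hlim tendsto_const_nhds
    rw [zero_smul, ← hφ.profile_sq] at h0
    simp [hzero] at h0
  -- With `σ = (h + 1) / 2` and `τ = (h - 1) / 2`, `h = σ ^ 2 - τ ^ 2` writes any Hermitian matrix
  -- as a difference of Gram matrices, continuously in `h`.
  let σ : H F q → H F q := fun h => (2⁻¹ : ℝ) • (h + 1)
  let τ : H F q → H F q := fun h => (2⁻¹ : ℝ) • (h - 1)
  have hστ : ∀ h : H F q, (σ h : Matrix (Fin q) (Fin q) F) ^ 2 =
      (τ h : Matrix (Fin q) (Fin q) F) ^ 2 + h := by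
    intro h
    have e1 : (σ h : Matrix (Fin q) (Fin q) F) = (2⁻¹ : ℝ) • ((h : Matrix (Fin q) (Fin q) F) + 1) :=
      rfl
    have e2 : (τ h : Matrix (Fin q) (Fin q) F) = (2⁻¹ : ℝ) • ((h : Matrix (Fin q) (Fin q) F) - 1) :=
      rfl
    rw [e1, e2, smul_pow, smul_pow, ← sub_eq_iff_eq_add', ← smul_sub]
    have e3 : ((h : Matrix (Fin q) (Fin q) F) + 1) ^ 2 - ((h : Matrix (Fin q) (Fin q) F) - 1) ^ 2 =
        (4 : ℝ) • (h : Matrix (Fin q) (Fin q) F) := by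
      rw [show (4 : ℝ) = ((4 : ℕ) : ℝ) by norm_num, Nat.cast_smul_eq_nsmul]
      noncomm_ring
    rw [e3, smul_smul]
    norm_num
  let f : H F q → ℂ := fun h => φ (gOf (σ h)) / φ (gOf (τ h))
  have hf : ∀ v, Continuous fun t : ℝ => f (t • v) := by
    intro v
    have h1 : Continuous fun t : ℝ => t • v := continuous_id.smul continuous_const
    have h2 : Continuous fun t : ℝ => σ (t • v) := (h1.add (continuous_const (y := 1))).const_smul (2⁻¹ : ℝ)
    have h3 : Continuous fun t : ℝ => τ (t • v) := (h1.sub (continuous_const (y := 1))).const_smul (2⁻¹ : ℝ)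
    exact (hcont.comp h2).div (hcont.comp h3) fun _ => hnz _
  have hf0 : f 0 = 1 := by
    have : φ (gOf (σ (0 : H F q))) = φ (gOf (τ (0 : H F q))) := by
      rw [← hφ.profile_sq, ← hφ.profile_sq, hστ]
      simp
    simp only [f, this, div_self (hnz _)]
  have hadd : ∀ v w, f (v + w) = f v * f w := by
    intro v w
    -- The identity `f (v + w) = f v * f w` with denominators cleared: both arguments are the sum of
    -- the three `τ ^ 2` and `v + w`.
    have h1 : profile φ ((σ (v + w) : Matrix (Fin q) (Fin q) F) ^ 2 +
        ((τ v : Matrix (Fin q) (Fin q) F) ^ 2 + (τ w : Matrix (Fin q) (Fin q) F) ^ 2)) =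
        profile φ ((τ (v + w) : Matrix (Fin q) (Fin q) F) ^ 2 +
        ((σ v : Matrix (Fin q) (Fin q) F) ^ 2 + (σ w : Matrix (Fin q) (Fin q) F) ^ 2)) := by
      congr 1
      rw [hστ, hστ, hστ, AddSubgroup.coe_add]
      abel
    rw [hmul _ _ (isGram_sq _) ((isGram_sq _).add (isGram_sq _)),
      hmul _ _ (isGram_sq _) ((isGram_sq _).add (isGram_sq _)),
      hmul _ _ (isGram_sq _) (isGram_sq _), hmul _ _ (isGram_sq _) (isGram_sq _)] at h1
    simp only [hφ.profile_sq] at h1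
    simp only [f]
    rw [div_mul_div_comm, div_eq_div_iff (hnz _) (mul_ne_zero (hnz _) (hnz _)), h1, mul_comm]
  obtain ⟨L, hL⟩ := exists_linearMap_eq_exp hf hf0 hadd
  refine ⟨L, fun a => ?_⟩
  rw [← hL]
  -- On the Gram matrix `a ^ 2` the extension agrees with the profile, as `σ ^ 2 = τ ^ 2 + a ^ 2`.
  refine (div_eq_iff (hnz _)).2 ?_ |>.symm
  rw [← hφ.profile_sq, hστ]
  change profile φ (_ + (a : Matrix (Fin q) (Fin q) F) ^ 2) = _
  rw [hmul _ _ (isGram_sq _) (isGram_sq _), hφ.profile_sq, hφ.profile_sq, mul_comm]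

theorem isOlshanskiSpherical_iff_exists_psi (hc : Continuous φ) (hφ : IsBiinvariant φ) :
    IsOlshanskiSpherical φ ↔ ∃ b : HC F q, ∀ a ∈ posCone F q, φ (gOf a) = psi b a := by
  rw [hφ.isOlshanskiSpherical_iff hc]
  constructor
  · rintro ⟨hne, hmul⟩
    obtain ⟨L, hL⟩ := hφ.exists_linearMap hc hne hmul
    obtain ⟨b, hb⟩ := exists_scalar_eq (-(Complex.reLm ∘ₗ L))
    obtain ⟨d, hd⟩ := exists_scalar_eq (-(Complex.imLm ∘ₗ L))
    refine ⟨⟨b, d⟩, fun a _ => ?_⟩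
    rw [hL, psi_eq, ← hb, ← hd]
    congr 1
    apply Complex.ext <;> simp
  · rintro ⟨b, hb⟩
    have hsq : ∀ {s : Matrix (Fin q) (Fin q) F} {a : H F q}, (a : Matrix (Fin q) (Fin q) F) ^ 2 = s →
        profile φ s = φ (gOf a) := fun h => h ▸ hφ.profile_sq _
    refine ⟨⟨0, ⟨0, 0, by simp⟩, ?_⟩, fun s t hs ht => ?_⟩
    · rw [hsq (s := 0) (a := 0) (zero_pow two_ne_zero),
        hb 0 ⟨0, Subtype.ext (zero_pow two_ne_zero).symm⟩]
      exact Complex.exp_ne_zero _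
    · obtain ⟨a, ha, has⟩ := hs.exists_posCone
      obtain ⟨c, hcc, hct⟩ := ht.exists_posCone
      -- The formula for `φ` is given only on the cone, so the root of `s + t` must also be taken
      -- there.
      obtain ⟨d, hd, hds⟩ := (hs.add ht).exists_posCone
      have hsum : d ^ 2 = a ^ 2 + c ^ 2 := Subtype.ext (by
        change (d : Matrix (Fin q) (Fin q) F) ^ 2 =
          (a : Matrix (Fin q) (Fin q) F) ^ 2 + (c : Matrix (Fin q) (Fin q) F) ^ 2
        rw [has, hct, hds])
      rw [hsq has, hsq hct, hsq hds, hb a ha, hb c hcc, hb d hd, psi_eq, psi_eq, psi_eq, hsum,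
        ← Complex.exp_add]
      congr 1
      simp only [← scalarForm_apply, map_add, Complex.ofReal_add]
      ring

end

end OlshanskiMotion

theorem theorem4p5 (q : ℕ) :
    (∀ φ : OlshanskiMotion.GInf ℝ q → ℂ, Continuous φ → OlshanskiMotion.IsBiinvariant φ →
      (OlshanskiMotion.IsOlshanskiSpherical φ ↔
        ∃ b : OlshanskiMotion.HC ℝ q, ∀ a ∈ OlshanskiMotion.posCone ℝ q,
          φ (OlshanskiMotion.gOf a) = OlshanskiMotion.psi b a)) ∧
    (∀ φ : OlshanskiMotion.GInf ℂ q → ℂ, Continuous φ → OlshanskiMotion.IsBiinvariant φ →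
      (OlshanskiMotion.IsOlshanskiSpherical φ ↔
        ∃ b : OlshanskiMotion.HC ℂ q, ∀ a ∈ OlshanskiMotion.posCone ℂ q,
          φ (OlshanskiMotion.gOf a) = OlshanskiMotion.psi b a)) ∧
    (∀ φ : OlshanskiMotion.GInf ℍ[ℝ] q → ℂ, Continuous φ → OlshanskiMotion.IsBiinvariant φ →
      (OlshanskiMotion.IsOlshanskiSpherical φ ↔
        ∃ b : OlshanskiMotion.HC ℍ[ℝ] q, ∀ a ∈ OlshanskiMotion.posCone ℍ[ℝ] q,
          φ (OlshanskiMotion.gOf a) = OlshanskiMotion.psi b a)) := by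
  exact ⟨fun _ => OlshanskiMotion.isOlshanskiSpherical_iff_exists_psi,
    fun _ => OlshanskiMotion.isOlshanskiSpherical_iff_exists_psi,
    fun _ => OlshanskiMotion.isOlshanskiSpherical_iff_exists_psi⟩
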